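/- There is an absolute constant $c_0>0$ with the following property. Let $\mathcal L^\star\in\mathbb R^{d_1\times\cdots\times d_n}$ be a rank-$(r_1,\ldots,r_n)$ Tucker tensor, that is, $\mathcal L^\star=\mathcal C\times_1\mathbf U_1\times_2\cdots\times_n\mathbf U_n$ with a core tensor $\mathcal C\in\mathbb R^{r_1\times\cdots\times r_n}$ and factor matrices $\mathbf U_k\in\mathbb R^{d_k\times r_k}$ with orthonormal columns ($\mathbf U_k^\top\mathbf U_k=\mathbf I$). Assume that the factor matrices are $\mu$-incoherent: $$\max_{1\le j\le d_k}\|\mathbf U_k(j,:)\|_2\le\sqrt{\frac{\mu r_k}{d_k}}\qquad\text{for all }k\in[n].$$ Let $i\in[n]$ be any mode (with $r_i\ge 1$), let $\delta\in(0,1)$, and let $I_i$ be a uniformly random subset of $[d_i]$ of fixed cardinality $|I_i|\le d_i$ with $$|I_i|\ge c_0\,\mu\, r_i\log^3\!\left(\frac{\mu r_i}{\delta}\right).$$ Then, with probability at least $1-\delta$, the row submatrix $\mathbf U_i(I_i,:)$ satisfies $$\frac12\sqrt{\frac{|I_i|}{d_i}}\le\sigma_{\min}\big(\mathbf U_i(I_i,:)\big)\le\sigma_{\max}\big(\mathbf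 U_i(I_i,:)\big)\le\frac32\sqrt{\frac{|I_i|}{d_i}},$$ where $\sigma_{\max}$ and $\sigma_{\min}$ denote the largest and the $r_i$-th largest (smallest) singular values. -/

import Mathlib

/-- A real tensor of size `d 0 × ⋯ × d (n - 1)`: a function of one index per mode. -/
abbrev RealTensor {n : ℕ} (d : Fin n → ℕ) : Type := (∀ k, Fin (d k)) → ℝ

/-- The simultaneous mode-`k` product `C ×₁ U₁ ×₂ U₂ ⋯ ×ₙ Uₙ` of a core tensor with one matrix per
mode. Entrywise, it is the sum over all core indices `j` of `C j * ∏ k, U k (i k) (j k)`. -/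
noncomputable def tuckerProduct {n : ℕ} {d r : Fin n → ℕ} (C : RealTensor r)
    (U : ∀ k, Matrix (Fin (d k)) (Fin (r k)) ℝ) : RealTensor d :=
  fun i => ∑ j : ∀ k, Fin (r k), C j * ∏ k, U k (i k) (j k)

/-- `U` is a system of (orthonormal) factor matrices of an exact Tucker decomposition of `L` with
core tensor of size `r 0 × ⋯ × r (n - 1)`. -/
structure IsTuckerFactorSystem {n : ℕ} {d r : Fin n → ℕ} (L : RealTensor d)
    (U : ∀ k, Matrix (Fin (d k)) (Fin (r k)) ℝ) : Prop where
  /-- The tensor is the product of a core tensor with the factor matrices. -/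
  exact_decomposition : ∃ C : RealTensor r, L = tuckerProduct C U
  /-- Every factor matrix has orthonormal columns. -/
  orthonormal_columns : ∀ k, (U k).transpose * U k = 1

/-- `μ`-incoherence of a `d × r` matrix: every row has Euclidean norm at most `√(μ r / d)`. -/
def IsIncoherent {d r : ℕ} (U : Matrix (Fin d) (Fin r) ℝ) (μ : ℝ) : Prop :=
  ∀ j : Fin d, ‖WithLp.toLp 2 (U j)‖ ≤ √(μ * r / d)

/-- The row submatrix `U(I, :)`. -/
def rowSubmatrix {d r : ℕ} (U : Matrix (Fin d) (Fin r) ℝ) (I : Finset (Fin d)) :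
    Matrix I (Fin r) ℝ :=
  U.submatrix Subtype.val id

/-- The largest singular value of a matrix (singular values are listed in decreasing order,
starting from index `0`). -/
noncomputable def sigmaMax {ι : Type*} [Fintype ι] {r : ℕ} (A : Matrix ι (Fin r) ℝ) : ℝ :=
  (Matrix.toEuclideanLin A).singularValues 0

/-- The smallest singular value of a matrix with `r ≥ 1` columns: the `r`-th largest one, that is,
the square root of the smallest eigenvalue of `Aᵀ A`. -/
noncomputable def sigmaMin {ι : Type*} [Fintype ι] {r : ℕ} (A : Matrix ι (Fin r) ℝ) : ℝ :=
  (Matrix.toEuclideanLin A).singularValues (r - 1)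

/-- The law of a uniformly random subset of `{1, …, d}` with exactly `m` elements (sampling of `m`
indices without replacement). It is a probability measure as soon as `m ≤ d`. -/
noncomputable def uniformSubset (d m : ℕ) : MeasureTheory.Measure (Finset (Fin d)) :=
  ProbabilityTheory.uniformOn {I | I.card = m}

/-!
The rows `a j` of a matrix with orthonormal columns form a Parseval frame, `∑ j, a j ⊗ a j = 1`, and
the squared singular values of the row submatrix on `I` are eigenvalues of
`S I = ∑ j ∈ I, a j ⊗ a j` (`adjoint_comp_self_rowSubmatrix`). With `b = μ r / d` bounding the
squared row norms, the claim follows from a matrix Chernoff bound for sampling without replacement: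
all eigenvalues of `S I` lie in `[1 / 4, 9 / 4] · m / d`, except with probability at most
`3 r exp (-m / (64 b d))` (`subsetAverage_escape_le`).

The Chernoff bound controls the mean of the potential `tr exp (± θ S I)` while the set grows by one
uniformly random element at a time (`subsetAverage_succ`). The effect of one step is bounded by two
elementary facts that replace the Golden–Thompson inequality for rank-one increments: Klein's
inequality `sum_exp_sub_sum_exp_le`, and `sum_exp_mul_sq_inner_perturbation_le`, which says that
`⟨a, exp (T + a ⊗ a) a⟩ ≤ exp (‖a‖ ^ 2) ⟨a, exp T a⟩`. The latter is proved moment by moment, with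
Chebyshev's sum inequality merging products of spectral sums. Averaged over the elements `j` outside
the current set `J`, the increments `a j ⊗ a j` sum to `1 - S J`. For the largest eigenvalue
`1 - S J ≤ 1` suffices; for the smallest one, `1 - S J ≥ 1 / 2` on the eigenspaces with eigenvalue at
most `1 / 2`, and the other eigenspaces contribute at most `r exp (-θ / 2)` to the potential.

The cubed logarithm exceeds a multiple of the logarithm that the Chernoff bound needs as long as
`μ r / δ ≥ 2`. Otherwise `r = 1` and `μ < 2 δ`, so that the matrix is a nearly flat vector and
Markov's inequality suffices, even for a single sample
(`subsetAverage_escape_le_of_finrank_eq_one`).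
-/

/-! ### Weighted Chebyshev inequality -/


/-- Chebyshev's sum inequality with nonnegative weights. -/
theorem sum_mul_sum_le_of_monovary {κ : Type*} [Fintype κ] {w f g : κ → ℝ} (hw : ∀ k, 0 ≤ w k)
    (hfg : ∀ k l, 0 ≤ (f k - f l) * (g k - g l)) :
    (∑ k, w k * f k) * (∑ k, w k * g k) ≤ (∑ k, w k) * ∑ k, w k * (f k * g k) := by
  have h : 0 ≤ ∑ k, ∑ l, w k * w l * ((f k - f l) * (g k - g l)) :=
    Finset.sum_nonneg fun k _ => Finset.sum_nonneg fun l _ =>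
      mul_nonneg (mul_nonneg (hw k) (hw l)) (hfg k l)
  have e : ∑ k, ∑ l, w k * w l * ((f k - f l) * (g k - g l)) =
      ((∑ k, w k * (f k * g k)) * (∑ k, w k) + (∑ k, w k) * ∑ k, w k * (f k * g k)) -
      ((∑ k, w k * f k) * (∑ k, w k * g k) + (∑ k, w k * g k) * (∑ k, w k * f k)) := by
    simp only [Finset.sum_mul_sum, ← Finset.sum_add_distrib, ← Finset.sum_sub_distrib]
    exact Finset.sum_congr rfl fun k _ => Finset.sum_congr rfl fun l _ => by ring
  linarith

/-! ### Rank-one perturbations and the exponential -/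

section Perturbation

variable {E : Type*} [NormedAddCommGroup E] [InnerProductSpace ℝ E] {κ κ' : Type*} [Fintype κ]
  [Fintype κ'] {T T' : E →ₗ[ℝ] E} {u : OrthonormalBasis κ ℝ E} {l : κ → ℝ}
  {u' : OrthonormalBasis κ' ℝ E} {l' : κ' → ℝ} {a : E}

theorem pow_apply_of_apply_eq_smul {v : E} {c : ℝ} (h : T v = c • v) (q : ℕ) :
    (T ^ q) v = c ^ q • v := by
  induction q with
  | zero => simp
  | succ q ih => rw [pow_succ, Module.End.mul_apply, h, map_smul, ih, smul_smul, pow_succ']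

theorem inner_pow_apply_eq_sum (hT : T.IsSymmetric) (hu : ∀ k, T (u k) = l k • u k) (a v : E)
    (q : ℕ) : inner ℝ ((T ^ q) a) v = ∑ k, l k ^ q * (inner ℝ (u k) a * inner ℝ (u k) v) := by
  rw [← u.sum_inner_mul_inner]
  refine Finset.sum_congr rfl fun k _ => ?_
  rw [hT.pow q, pow_apply_of_apply_eq_smul (hu k), inner_smul_right, real_inner_comm a]
  ring

theorem sum_sq_inner_eq_norm_sq (u : OrthonormalBasis κ ℝ E) (a : E) :
    ∑ k, inner ℝ (u k) a ^ 2 = ‖a‖ ^ 2 := by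
  rw [← u.sum_sq_norm_inner_right]
  simp

theorem isSymmetric_of_apply_eq_add (hT : T.IsSymmetric)
    (h : ∀ v, T' v = T v + inner ℝ a v • a) : T'.IsSymmetric := by
  intro v w
  rw [h, h, inner_add_left, inner_add_right, hT, inner_smul_left, inner_smul_right]
  simp only [RCLike.conj_to_real, real_inner_comm a]
  ring

/-- Moments of a rank-one perturbation `T' = T + a ⊗ a` of a positive operator `T` are at most
those obtained when the perturbation is replaced by the scalar `‖a‖ ^ 2`. -/
theorem inner_pow_perturbation_le (hT : T.IsSymmetric) (hu : ∀ k, T (u k) = l k • u k)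
    (hl : ∀ k, 0 ≤ l k) (h : ∀ v, T' v = T v + inner ℝ a v • a) (j i : ℕ) :
    inner ℝ ((T ^ i) a) ((T' ^ j) a) ≤
      ∑ k, inner ℝ (u k) a ^ 2 * (l k ^ i * (l k + ‖a‖ ^ 2) ^ j) := by
  induction j generalizing i with
  | zero =>
    rw [pow_zero, Module.End.one_apply, inner_pow_apply_eq_sum hT hu]
    exact (Finset.sum_congr rfl fun k _ => by ring).le
  | succ j ih =>
    have h0 := ih 0
    have h1 := ih (i + 1)
    rw [pow_zero, Module.End.one_apply] at h0
    have hm : inner ℝ ((T ^ i) a) a = ∑ k, inner ℝ (u k) a ^ 2 * l k ^ i := by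
      rw [inner_pow_apply_eq_sum hT hu]
      exact Finset.sum_congr rfl fun k _ => by ring
    have hm0 : 0 ≤ inner ℝ ((T ^ i) a) a := by
      rw [hm]
      exact Finset.sum_nonneg fun k _ => mul_nonneg (sq_nonneg _) (pow_nonneg (hl k) _)
    have hrec : inner ℝ ((T ^ i) a) ((T' ^ (j + 1)) a) = inner ℝ ((T ^ (i + 1)) a) ((T' ^ j) a) +
        inner ℝ ((T ^ i) a) a * inner ℝ a ((T' ^ j) a) := by
      rw [pow_succ', Module.End.mul_apply, h, inner_add_right, inner_smul_right, ← hT,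
        ← Module.End.mul_apply, ← pow_succ']
      ring
    -- Both factors increase with the eigenvalue, so Chebyshev merges the two sums.
    have hch := sum_mul_sum_le_of_monovary (w := fun k => inner ℝ (u k) a ^ 2)
      (f := fun k => l k ^ i) (g := fun k => (l k + ‖a‖ ^ 2) ^ j) (fun k => sq_nonneg _) (by
        intro k k'
        rcases le_total (l k) (l k') with hle | hle
        · exact mul_nonneg_of_nonpos_of_nonpos
            (sub_nonpos.2 (pow_le_pow_left₀ (hl k) hle i))
            (sub_nonpos.2 (pow_le_pow_left₀ (add_nonneg (hl k) (sq_nonneg _)) (by linarith) j))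
        · exact mul_nonneg
            (sub_nonneg.2 (pow_le_pow_left₀ (hl k') hle i))
            (sub_nonneg.2 (pow_le_pow_left₀ (add_nonneg (hl k') (sq_nonneg _)) (by linarith) j)))
    rw [sum_sq_inner_eq_norm_sq] at hch
    calc inner ℝ ((T ^ i) a) ((T' ^ (j + 1)) a)
        ≤ ∑ k, inner ℝ (u k) a ^ 2 * (l k ^ (i + 1) * (l k + ‖a‖ ^ 2) ^ j) +
          (∑ k, inner ℝ (u k) a ^ 2 * l k ^ i) *
            ∑ k, inner ℝ (u k) a ^ 2 * (l k + ‖a‖ ^ 2) ^ j := by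
          rw [hrec]
          refine add_le_add h1 ?_
          rw [← hm]
          refine mul_le_mul_of_nonneg_left (h0.trans (le_of_eq ?_)) hm0
          simp
      _ ≤ _ := by
          refine (add_le_add_right hch _).trans (le_of_eq ?_)
          rw [Finset.mul_sum, ← Finset.sum_add_distrib]
          exact Finset.sum_congr rfl fun k _ => by ring

/-- A finite combination of exponentials is the exponential generating series of its moments. -/
theorem hasSum_sum_mul_exp (w x : κ → ℝ) :
    HasSum (fun q : ℕ => (∑ k, w k * x k ^ q) / (q.factorial : ℝ)) (∑ k, w k * Real.exp (x k)) := by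
  simp only [Finset.sum_div]
  refine hasSum_sum fun k _ => ?_
  have := (NormedSpace.expSeries_div_hasSum_exp (𝔸 := ℝ) (x k)).mul_left (w k)
  rw [← Real.exp_eq_exp_ℝ] at this
  simpa only [mul_div_assoc] using this

theorem sum_exp_mul_sq_inner_perturbation_le_of_nonneg (hT : T.IsSymmetric)
    (hu : ∀ k, T (u k) = l k • u k) (hl : ∀ k, 0 ≤ l k)
    (h : ∀ v, T' v = T v + inner ℝ a v • a) (hu' : ∀ k, T' (u' k) = l' k • u' k) :
    ∑ k, inner ℝ (u' k) a ^ 2 * Real.exp (l' k) ≤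
      Real.exp (‖a‖ ^ 2) * ∑ k, inner ℝ (u k) a ^ 2 * Real.exp (l k) := by
  have e : Real.exp (‖a‖ ^ 2) * ∑ k, inner ℝ (u k) a ^ 2 * Real.exp (l k) =
      ∑ k, inner ℝ (u k) a ^ 2 * Real.exp (l k + ‖a‖ ^ 2) := by
    rw [Finset.mul_sum]
    exact Finset.sum_congr rfl fun k _ => by rw [Real.exp_add]; ring
  rw [e]
  refine hasSum_le (fun q => ?_) (hasSum_sum_mul_exp _ _) (hasSum_sum_mul_exp _ _)
  refine div_le_div_of_nonneg_right ?_ (Nat.cast_nonneg _)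
  have hm := inner_pow_perturbation_le hT hu hl h q 0
  rw [pow_zero, Module.End.one_apply, real_inner_comm,
    inner_pow_apply_eq_sum (isSymmetric_of_apply_eq_add hT h) hu'] at hm
  refine (Finset.sum_congr rfl fun k _ => ?_).le.trans
    (hm.trans (Finset.sum_congr rfl fun k _ => ?_).le)
  · ring
  · ring

/-- For `T' = T + a ⊗ a`, the quadratic form of `exp T'` at `a` is at most `exp (‖a‖ ^ 2)` times
that of `exp T`. Adding a scalar to `T` reduces this to positive `T`, where the
exponential series are compared termwise. -/
theorem sum_exp_mul_sq_inner_perturbation_le (hT : T.IsSymmetric)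
    (hu : ∀ k, T (u k) = l k • u k)
    (h : ∀ v, T' v = T v + inner ℝ a v • a) (hu' : ∀ k, T' (u' k) = l' k • u' k) :
    ∑ k, inner ℝ (u' k) a ^ 2 * Real.exp (l' k) ≤
      Real.exp (‖a‖ ^ 2) * ∑ k, inner ℝ (u k) a ^ 2 * Real.exp (l k) := by
  set c : ℝ := ∑ k, |l k| with hc
  have hlc : ∀ k, 0 ≤ l k + c := fun k => by
    have := Finset.single_le_sum (f := fun k => |l k|) (fun k _ => abs_nonneg _) (Finset.mem_univ k)
    have := neg_abs_le (l k)
    linarith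
  have key := sum_exp_mul_sq_inner_perturbation_le_of_nonneg (T := T + c • LinearMap.id)
    (T' := T' + c • LinearMap.id) (u := u) (u' := u') (a := a) (l := fun k => l k + c)
    (l' := fun k => l' k + c)
    (by
      intro v w
      simp [inner_add_left, inner_add_right, inner_smul_left, inner_smul_right, hT v w])
    (fun k => by simp [hu, add_smul]) hlc (fun v => by simp [h]; abel)
    (fun k => by simp [hu', add_smul])
  have e : ∑ k, inner ℝ (u k) a ^ 2 * Real.exp (l k + c) =
      Real.exp c * ∑ k, inner ℝ (u k) a ^ 2 * Real.exp (l k) := by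
    rw [Finset.mul_sum]
    exact Finset.sum_congr rfl fun k _ => by rw [Real.exp_add]; ring
  have e' : ∑ k, inner ℝ (u' k) a ^ 2 * Real.exp (l' k + c) =
      Real.exp c * ∑ k, inner ℝ (u' k) a ^ 2 * Real.exp (l' k) := by
    rw [Finset.mul_sum]
    exact Finset.sum_congr rfl fun k _ => by rw [Real.exp_add]; ring
  rw [e, e', mul_left_comm] at key
  exact le_of_mul_le_mul_left key (Real.exp_pos c)

/-- Klein's inequality for the exponential: `tr exp T - tr exp T' ≤ tr (exp T (T - T'))`. Expanding
in the two eigenbases reduces it to the tangent-line inequality for the scalar exponential. -/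
theorem sum_exp_sub_sum_exp_le (hT' : T'.IsSymmetric) (hu : ∀ k, T (u k) = l k • u k)
    (hu' : ∀ k, T' (u' k) = l' k • u' k) :
    ∑ k, Real.exp (l k) - ∑ k, Real.exp (l' k) ≤
      ∑ k, Real.exp (l k) * inner ℝ (u k) ((T - T') (u k)) := by
  have h1 : ∀ k, ∑ k', inner ℝ (u' k') (u k) ^ 2 = 1 := fun k => by
    rw [sum_sq_inner_eq_norm_sq, u.norm_eq_one, one_pow]
  have h2 : ∀ k', ∑ k, inner ℝ (u' k') (u k) ^ 2 = 1 := fun k' => by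
    simp only [real_inner_comm _ (u' k')]
    rw [sum_sq_inner_eq_norm_sq, u'.norm_eq_one, one_pow]
  have h3 : ∀ k, inner ℝ (u k) (T' (u k)) = ∑ k', inner ℝ (u' k') (u k) ^ 2 * l' k' := fun k => by
    have := inner_pow_apply_eq_sum hT' hu' (u k) (u k) 1
    rw [pow_one, real_inner_comm] at this
    rw [this]
    exact Finset.sum_congr rfl fun k _ => by ring
  have e1 : ∑ k, Real.exp (l k) = ∑ k, ∑ k', inner ℝ (u' k') (u k) ^ 2 * Real.exp (l k) :=
    Finset.sum_congr rfl fun k _ => by rw [← Finset.sum_mul, h1, one_mul]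
  have e2 : ∑ k', Real.exp (l' k') = ∑ k, ∑ k', inner ℝ (u' k') (u k) ^ 2 * Real.exp (l' k') := by
    rw [Finset.sum_comm]
    exact Finset.sum_congr rfl fun k _ => by rw [← Finset.sum_mul, h2, one_mul]
  have e3 : ∑ k, Real.exp (l k) * inner ℝ (u k) ((T - T') (u k)) =
      ∑ k, ∑ k', inner ℝ (u' k') (u k) ^ 2 * (Real.exp (l k) * (l k - l' k')) := by
    refine Finset.sum_congr rfl fun k _ => ?_
    rw [LinearMap.sub_apply, inner_sub_right, hu, inner_smul_right, real_inner_self_eq_norm_sq,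
      u.norm_eq_one, h3, one_pow, mul_one]
    simp only [mul_sub, Finset.sum_sub_distrib]
    rw [← Finset.sum_mul, h1, one_mul, Finset.mul_sum]
    congr 1
    exact Finset.sum_congr rfl fun k _ => by ring
  rw [e1, e2, e3, ← Finset.sum_sub_distrib]
  refine Finset.sum_le_sum fun k _ => ?_
  rw [← Finset.sum_sub_distrib]
  refine Finset.sum_le_sum fun k' _ => ?_
  rw [← mul_sub]
  refine mul_le_mul_of_nonneg_left ?_ (sq_nonneg _)
  have h4 : Real.exp (l' k') = Real.exp (l k) * Real.exp (l' k' - l k) := by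
    rw [← Real.exp_add]; ring_nf
  rw [h4]
  nlinarith [Real.add_one_le_exp (l' k' - l k), Real.exp_pos (l k)]

end Perturbation

/-! ### Averages over subsets of fixed size -/

section Average

variable {ι : Type*} [Fintype ι]

/-- The mean of `f` over all subsets of `ι` with exactly `m` elements. It is a genuine mean only for
`m ≤ card ι`; otherwise both the sum and the number of subsets vanish and the value is `0`. -/
noncomputable def subsetAverage (ι : Type*) [Fintype ι] (m : ℕ) (f : Finset ι → ℝ) : ℝ :=
  (∑ I ∈ (Finset.univ : Finset ι).powersetCard m, f I) / ((Fintype.card ι).choose m : ℝ)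

theorem subsetAverage_mono {m : ℕ} {f g : Finset ι → ℝ} (h : ∀ I, I.card = m → f I ≤ g I) :
    subsetAverage ι m f ≤ subsetAverage ι m g :=
  div_le_div_of_nonneg_right
    (Finset.sum_le_sum fun I hI => h I (Finset.mem_powersetCard.1 hI).2) (Nat.cast_nonneg _)

theorem subsetAverage_const {m : ℕ} (hm : m ≤ Fintype.card ι) (c : ℝ) :
    subsetAverage ι m (fun _ => c) = c := by
  have : ((Fintype.card ι).choose m : ℝ) ≠ 0 := by exact_mod_cast (Nat.choose_pos hm).ne'
  rw [subsetAverage, Finset.sum_const, Finset.card_powersetCard, Finset.card_univ, nsmul_eq_mul]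
  field_simp

theorem subsetAverage_add (m : ℕ) (f g : Finset ι → ℝ) :
    subsetAverage ι m (fun I => f I + g I) = subsetAverage ι m f + subsetAverage ι m g := by
  rw [subsetAverage, Finset.sum_add_distrib, add_div]; rfl

theorem subsetAverage_const_mul (m : ℕ) (c : ℝ) (f : Finset ι → ℝ) :
    subsetAverage ι m (fun I => c * f I) = c * subsetAverage ι m f := by
  rw [subsetAverage, ← Finset.mul_sum, mul_div_assoc]; rfl

theorem subsetAverage_zero (f : Finset ι → ℝ) : subsetAverage ι 0 f = f ∅ := by
  simp [subsetAverage]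

/-- Markov's inequality for a uniformly random subset. -/
theorem subsetAverage_ite_le {m : ℕ} {f : Finset ι → ℝ} {p : Finset ι → Prop} [DecidablePred p]
    {t : ℝ} (ht : 0 < t) (hf : ∀ I, I.card = m → 0 ≤ f I) (hp : ∀ I, I.card = m → p I → t ≤ f I) :
    subsetAverage ι m (fun I => if p I then 1 else 0) ≤ t⁻¹ * subsetAverage ι m f := by
  rw [← subsetAverage_const_mul]
  refine subsetAverage_mono fun I hI => ?_
  split_ifs with h
  · rw [inv_mul_eq_div, one_le_div ht]
    exact hp I hI h
  · exact mul_nonneg (inv_nonneg.2 ht.le) (hf I hI)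

variable [DecidableEq ι]

theorem sum_powersetCard_sum_insert (k : ℕ) (f : Finset ι → ℝ) :
    ∑ J ∈ (Finset.univ : Finset ι).powersetCard k, ∑ j ∈ Jᶜ, f (insert j J) =
      (k + 1) * ∑ I ∈ (Finset.univ : Finset ι).powersetCard (k + 1), f I := by
  have h : (k + 1 : ℝ) * ∑ I ∈ (Finset.univ : Finset ι).powersetCard (k + 1), f I =
      ∑ I ∈ (Finset.univ : Finset ι).powersetCard (k + 1), ∑ _j ∈ I, f I := by
    rw [Finset.mul_sum]
    refine Finset.sum_congr rfl fun I hI => ?_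
    rw [Finset.sum_const, (Finset.mem_powersetCard.1 hI).2, nsmul_eq_mul]
    push_cast
    ring
  rw [h, Finset.sum_sigma', Finset.sum_sigma']
  refine Finset.sum_bij' (fun x _ => ⟨insert x.2 x.1, x.2⟩) (fun x _ => ⟨x.1.erase x.2, x.2⟩)
    ?_ ?_ ?_ ?_ ?_
  · rintro ⟨J, j⟩ hx
    simp only [Finset.mem_sigma, Finset.mem_powersetCard, Finset.mem_compl] at hx ⊢
    exact ⟨⟨Finset.subset_univ _, by rw [Finset.card_insert_of_notMem hx.2, hx.1.2]⟩,
      Finset.mem_insert_self _ _⟩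
  · rintro ⟨I, j⟩ hx
    simp only [Finset.mem_sigma, Finset.mem_powersetCard, Finset.mem_compl] at hx ⊢
    exact ⟨⟨Finset.subset_univ _, by rw [Finset.card_erase_of_mem hx.2, hx.1.2]; rfl⟩,
      Finset.notMem_erase _ _⟩
  · rintro ⟨J, j⟩ hx
    simp only [Finset.mem_sigma, Finset.mem_compl] at hx
    simp [Finset.erase_insert hx.2]
  · rintro ⟨I, j⟩ hx
    simp only [Finset.mem_sigma] at hx
    simp [Finset.insert_erase hx.2]
  · rintro ⟨J, j⟩ _
    rfl

/-- A uniformly random subset of size `k + 1` arises from one of size `k` by adding a uniformly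
random new element. -/
theorem subsetAverage_succ {k : ℕ} (hk : k < Fintype.card ι) (f : Finset ι → ℝ) :
    subsetAverage ι (k + 1) f =
      subsetAverage ι k fun J => (∑ j ∈ Jᶜ, f (insert j J)) / ((Fintype.card ι : ℝ) - k) := by
  set d := Fintype.card ι with hd
  have h0 : (0 : ℝ) < (d : ℝ) - k := sub_pos.2 (by exact_mod_cast hk)
  have h1 : (0 : ℝ) < d.choose k := by exact_mod_cast Nat.choose_pos hk.le
  have h2 : (0 : ℝ) < d.choose (k + 1) := by exact_mod_cast Nat.choose_pos hk
  have h3 : (d.choose (k + 1) : ℝ) * (k + 1) = d.choose k * ((d : ℝ) - k) := by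
    have := Nat.choose_succ_right_eq d k
    rw [← Nat.cast_sub hk.le]
    exact_mod_cast this
  rw [subsetAverage, subsetAverage, ← Finset.sum_div, sum_powersetCard_sum_insert, ← hd, div_div,
    div_eq_div_iff h2.ne' (by positivity)]
  rw [mul_comm ((d : ℝ) - k), ← h3]
  ring

theorem subsetAverage_sum {k : ℕ} (hk : k ≤ Fintype.card ι) (x : ι → ℝ) :
    subsetAverage ι k (fun I => ∑ j ∈ I, x j) = k / Fintype.card ι * ∑ j, x j := by
  induction k with
  | zero => simp [subsetAverage_zero]
  | succ k ih =>
    have hk' : k < Fintype.card ι := hk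
    have h0 : (0 : ℝ) < (Fintype.card ι : ℝ) - k := sub_pos.2 (by exact_mod_cast hk')
    have hd : (0 : ℝ) < Fintype.card ι := by exact_mod_cast (Nat.zero_le k).trans_lt hk'
    have h : subsetAverage ι (k + 1) (fun I => ∑ j ∈ I, x j) =
        subsetAverage ι k (fun J => (1 - 1 / ((Fintype.card ι : ℝ) - k)) * ∑ j ∈ J, x j +
          1 / ((Fintype.card ι : ℝ) - k) * ∑ j, x j) := by
      rw [subsetAverage_succ hk']
      have hJ : ∀ J : Finset ι, J.card = k →
          (∑ j ∈ Jᶜ, ∑ i ∈ insert j J, x i) / ((Fintype.card ι : ℝ) - k) =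
          (1 - 1 / ((Fintype.card ι : ℝ) - k)) * ∑ j ∈ J, x j +
            1 / ((Fintype.card ι : ℝ) - k) * ∑ j, x j := by
        intro J hJ
        have hc : ((Jᶜ.card : ℕ) : ℝ) = (Fintype.card ι : ℝ) - k := by
          rw [Finset.card_compl, hJ, Nat.cast_sub hk'.le]
        rw [Finset.sum_congr rfl fun j hj => Finset.sum_insert (Finset.mem_compl.1 hj),
          Finset.sum_add_distrib, Finset.sum_const, nsmul_eq_mul, hc,
          ← Finset.sum_add_sum_compl J x]
        field_simp
        ring
      exact le_antisymm (subsetAverage_mono fun J h => (hJ J h).le)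
        (subsetAverage_mono fun J h => (hJ J h).ge)
    rw [h, subsetAverage_add, subsetAverage_const_mul, subsetAverage_const hk'.le, ih hk'.le]
    push_cast
    field_simp
    ring

end Average

/-! ### Random subsets of a Parseval frame -/

section Frame

variable {E : Type*} [NormedAddCommGroup E] [InnerProductSpace ℝ E]
  {ι : Type*} {a : ι → E}

/-- The frame operator `∑ j ∈ I, a j ⊗ a j` of the vectors `a j` with index in `I`. -/
noncomputable def partialFrameOp (a : ι → E) (I : Finset ι) : E →ₗ[ℝ] E :=
  ∑ j ∈ I, (innerₗ E (a j)).smulRight (a j)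

theorem partialFrameOp_apply (I : Finset ι) (v : E) :
    partialFrameOp a I v = ∑ j ∈ I, inner ℝ (a j) v • a j := by
  simp [partialFrameOp, LinearMap.sum_apply]

theorem partialFrameOp_insert [DecidableEq ι] {J : Finset ι} {j : ι} (hj : j ∉ J) (v : E) :
    partialFrameOp a (insert j J) v = partialFrameOp a J v + inner ℝ (a j) v • a j := by
  rw [partialFrameOp_apply, Finset.sum_insert hj, partialFrameOp_apply, add_comm]

theorem inner_partialFrameOp (I : Finset ι) (v w : E) :
    inner ℝ v (partialFrameOp a I w) = ∑ j ∈ I, inner ℝ (a j) v * inner ℝ (a j) w := by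
  rw [partialFrameOp_apply, inner_sum]
  refine Finset.sum_congr rfl fun j _ => ?_
  rw [inner_smul_right, real_inner_comm v]
  ring

theorem inner_partialFrameOp_self (I : Finset ι) (v : E) :
    inner ℝ v (partialFrameOp a I v) = ∑ j ∈ I, inner ℝ (a j) v ^ 2 := by
  rw [inner_partialFrameOp]
  exact Finset.sum_congr rfl fun j _ => (sq _).symm

theorem isSymmetric_partialFrameOp (a : ι → E) (I : Finset ι) :
    (partialFrameOp a I).IsSymmetric := by
  intro v w
  rw [real_inner_comm, inner_partialFrameOp, inner_partialFrameOp]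
  exact Finset.sum_congr rfl fun j _ => mul_comm _ _

theorem isSymmetric_smul_partialFrameOp (a : ι → E) (c : ℝ) (I : Finset ι) :
    (c • partialFrameOp a I).IsSymmetric :=
  (isSymmetric_partialFrameOp a I).smul (by simp)

variable [FiniteDimensional ℝ E]

/-- The eigenvalues of the partial frame operator, in decreasing order. -/
noncomputable def frameEigenvalues (a : ι → E) (I : Finset ι) : Fin (Module.finrank ℝ E) → ℝ :=
  (isSymmetric_partialFrameOp a I).eigenvalues rfl

/-- An orthonormal eigenbasis of the partial frame operator. -/
noncomputable def frameEigenbasis (a : ι → E) (I : Finset ι) :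
    OrthonormalBasis (Fin (Module.finrank ℝ E)) ℝ E :=
  (isSymmetric_partialFrameOp a I).eigenvectorBasis rfl

/-- The trace of `exp (c • S)`, where `S` is the partial frame operator. -/
noncomputable def frameTraceExp (a : ι → E) (c : ℝ) (I : Finset ι) : ℝ :=
  ∑ i, Real.exp (c * frameEigenvalues a I i)

/-- The quadratic form of `exp (c • S)` at `v`, where `S` is the partial frame operator. -/
noncomputable def frameExpForm (a : ι → E) (c : ℝ) (I : Finset ι) (v : E) : ℝ :=
  ∑ i, inner ℝ (frameEigenbasis a I i) v ^ 2 * Real.exp (c * frameEigenvalues a I i)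

theorem partialFrameOp_apply_frameEigenbasis (I : Finset ι) (i : Fin (Module.finrank ℝ E)) :
    partialFrameOp a I (frameEigenbasis a I i) =
      frameEigenvalues a I i • frameEigenbasis a I i := by
  simp [frameEigenbasis, frameEigenvalues]

theorem frameEigenvalues_eq_sum (I : Finset ι) (i : Fin (Module.finrank ℝ E)) :
    frameEigenvalues a I i = ∑ j ∈ I, inner ℝ (a j) (frameEigenbasis a I i) ^ 2 := by
  rw [← inner_partialFrameOp_self, partialFrameOp_apply_frameEigenbasis, inner_smul_right,
    real_inner_self_eq_norm_sq, OrthonormalBasis.norm_eq_one, one_pow, mul_one]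

theorem frameEigenvalues_nonneg (I : Finset ι) (i : Fin (Module.finrank ℝ E)) :
    0 ≤ frameEigenvalues a I i := by
  rw [frameEigenvalues_eq_sum]
  exact Finset.sum_nonneg fun j _ => sq_nonneg _

theorem frameExpForm_nonneg (c : ℝ) (I : Finset ι) (v : E) : 0 ≤ frameExpForm a c I v :=
  Finset.sum_nonneg fun _ _ => mul_nonneg (sq_nonneg _) (Real.exp_pos _).le

theorem frameTraceExp_nonneg (c : ℝ) (I : Finset ι) : 0 ≤ frameTraceExp a c I :=
  Finset.sum_nonneg fun _ _ => (Real.exp_pos _).le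

theorem frameTraceExp_empty (c : ℝ) : frameTraceExp a c ∅ = Module.finrank ℝ E := by
  simp [frameTraceExp, frameEigenvalues_eq_sum]

theorem smul_partialFrameOp_apply_frameEigenbasis (c : ℝ) (I : Finset ι)
    (i : Fin (Module.finrank ℝ E)) : (c • partialFrameOp a I) (frameEigenbasis a I i) =
      (c * frameEigenvalues a I i) • frameEigenbasis a I i := by
  rw [LinearMap.smul_apply, partialFrameOp_apply_frameEigenbasis, smul_smul]

variable [DecidableEq ι] {J : Finset ι} {j : ι}

/-- One step of the exponential potential, in the direction that controls the largest eigenvalue. -/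
theorem frameTraceExp_insert_le (hj : j ∉ J) {θ : ℝ} (hθ : 0 ≤ θ) :
    frameTraceExp a θ (insert j J) ≤
      frameTraceExp a θ J + θ * Real.exp (θ * ‖a j‖ ^ 2) * frameExpForm a θ J (a j) := by
  have hs : √θ * √θ = θ := Real.mul_self_sqrt hθ
  have hK := sum_exp_sub_sum_exp_le (isSymmetric_smul_partialFrameOp a θ J)
    (smul_partialFrameOp_apply_frameEigenbasis (a := a) θ (insert j J))
    (smul_partialFrameOp_apply_frameEigenbasis (a := a) θ J)
  have hG := sum_exp_mul_sq_inner_perturbation_le (isSymmetric_smul_partialFrameOp a θ J)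
    (smul_partialFrameOp_apply_frameEigenbasis (a := a) θ J) (a := √θ • a j)
    (T' := θ • partialFrameOp a (insert j J)) (fun v => by
      rw [LinearMap.smul_apply, LinearMap.smul_apply, partialFrameOp_insert hj, smul_add,
        inner_smul_left, smul_smul, smul_smul, RCLike.conj_to_real, mul_right_comm, hs])
    (smul_partialFrameOp_apply_frameEigenbasis (a := a) θ (insert j J))
  have hn : ‖√θ • a j‖ ^ 2 = θ * ‖a j‖ ^ 2 := by
    rw [norm_smul, mul_pow, Real.norm_eq_abs, sq_abs, Real.sq_sqrt hθ]
  simp only [inner_smul_right, mul_pow, Real.sq_sqrt hθ, mul_assoc, hn] at hG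
  rw [← Finset.mul_sum, ← Finset.mul_sum] at hG
  have hK' : ∑ k, Real.exp (θ * frameEigenvalues a (insert j J) k) *
      inner ℝ (frameEigenbasis a (insert j J) k)
        ((θ • partialFrameOp a (insert j J) - θ • partialFrameOp a J)
          (frameEigenbasis a (insert j J) k)) =
      θ * frameExpForm a θ (insert j J) (a j) := by
    rw [frameExpForm, Finset.mul_sum]
    refine Finset.sum_congr rfl fun k _ => ?_
    rw [← smul_sub, LinearMap.smul_apply, LinearMap.sub_apply, partialFrameOp_insert hj,
      add_sub_cancel_left, inner_smul_right, inner_smul_right, real_inner_comm (a j)]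
    ring
  rw [hK'] at hK
  simp only [frameTraceExp, frameExpForm] at *
  linarith

/-- One step of the exponential potential, in the direction that controls the smallest
eigenvalue. -/
theorem frameTraceExp_neg_insert_le (hj : j ∉ J) {θ : ℝ} (hθ : 0 ≤ θ) :
    frameTraceExp a (-θ) (insert j J) ≤ frameTraceExp a (-θ) J -
      θ * Real.exp (-(θ * ‖a j‖ ^ 2)) * frameExpForm a (-θ) J (a j) := by
  have hs : √θ * √θ = θ := Real.mul_self_sqrt hθ
  have hK := sum_exp_sub_sum_exp_le (isSymmetric_smul_partialFrameOp a (-θ) J)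
    (smul_partialFrameOp_apply_frameEigenbasis (a := a) (-θ) (insert j J))
    (smul_partialFrameOp_apply_frameEigenbasis (a := a) (-θ) J)
  have hG := sum_exp_mul_sq_inner_perturbation_le
    (isSymmetric_smul_partialFrameOp a (-θ) (insert j J))
    (smul_partialFrameOp_apply_frameEigenbasis (a := a) (-θ) (insert j J)) (a := √θ • a j)
    (T' := -θ • partialFrameOp a J) (fun v => by
      rw [LinearMap.smul_apply, LinearMap.smul_apply, partialFrameOp_insert hj, smul_add,
        inner_smul_left, smul_smul, smul_smul, RCLike.conj_to_real, mul_right_comm, hs, neg_mul,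
        neg_smul (θ * _), add_assoc, neg_add_cancel, add_zero])
    (smul_partialFrameOp_apply_frameEigenbasis (a := a) (-θ) J)
  have hn : ‖√θ • a j‖ ^ 2 = θ * ‖a j‖ ^ 2 := by
    rw [norm_smul, mul_pow, Real.norm_eq_abs, sq_abs, Real.sq_sqrt hθ]
  simp only [inner_smul_right, mul_pow, Real.sq_sqrt hθ, mul_assoc, hn] at hG
  rw [← Finset.mul_sum, ← Finset.mul_sum] at hG
  have hK' : ∑ k, Real.exp (-θ * frameEigenvalues a (insert j J) k) *
      inner ℝ (frameEigenbasis a (insert j J) k)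
        ((-θ • partialFrameOp a (insert j J) - -θ • partialFrameOp a J)
          (frameEigenbasis a (insert j J) k)) =
      -(θ * frameExpForm a (-θ) (insert j J) (a j)) := by
    rw [frameExpForm, Finset.mul_sum, ← Finset.sum_neg_distrib]
    refine Finset.sum_congr rfl fun k _ => ?_
    rw [← smul_sub, LinearMap.smul_apply, LinearMap.sub_apply, partialFrameOp_insert hj,
      add_sub_cancel_left, inner_smul_right, inner_smul_right, real_inner_comm (a j)]
    ring
  rw [hK'] at hK
  have hG' : Real.exp (-(θ * ‖a j‖ ^ 2)) * (θ * frameExpForm a (-θ) J (a j)) ≤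
      θ * frameExpForm a (-θ) (insert j J) (a j) := by
    rw [Real.exp_neg, inv_mul_le_iff₀ (Real.exp_pos _)]
    exact hG
  simp only [frameTraceExp] at *
  linarith

variable [Fintype ι] {b : ℝ}

theorem sum_compl_sq_inner_frameEigenbasis (ha : ∀ v, ∑ j, inner ℝ (a j) v ^ 2 = ‖v‖ ^ 2)
    (J : Finset ι) (i : Fin (Module.finrank ℝ E)) :
    ∑ j ∈ Jᶜ, inner ℝ (frameEigenbasis a J i) (a j) ^ 2 = 1 - frameEigenvalues a J i := by
  have h := ha (frameEigenbasis a J i)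
  rw [OrthonormalBasis.norm_eq_one, one_pow, ← Finset.sum_add_sum_compl J,
    ← frameEigenvalues_eq_sum] at h
  simp only [real_inner_comm (a _)]
  linarith

theorem frameEigenvalues_le_one (ha : ∀ v, ∑ j, inner ℝ (a j) v ^ 2 = ‖v‖ ^ 2) (J : Finset ι)
    (i : Fin (Module.finrank ℝ E)) : frameEigenvalues a J i ≤ 1 := by
  have := sum_compl_sq_inner_frameEigenbasis ha J i
  have h0 : 0 ≤ ∑ j ∈ Jᶜ, inner ℝ (frameEigenbasis a J i) (a j) ^ 2 :=
    Finset.sum_nonneg fun _ _ => sq_nonneg _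
  linarith

theorem sum_compl_frameExpForm (ha : ∀ v, ∑ j, inner ℝ (a j) v ^ 2 = ‖v‖ ^ 2) (c : ℝ)
    (J : Finset ι) : ∑ j ∈ Jᶜ, frameExpForm a c J (a j) =
      ∑ i, (1 - frameEigenvalues a J i) * Real.exp (c * frameEigenvalues a J i) := by
  simp only [frameExpForm]
  rw [Finset.sum_comm]
  exact Finset.sum_congr rfl fun i _ => by
    rw [← Finset.sum_mul, sum_compl_sq_inner_frameEigenbasis ha]

theorem sum_compl_frameExpForm_le (ha : ∀ v, ∑ j, inner ℝ (a j) v ^ 2 = ‖v‖ ^ 2) (c : ℝ)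
    (J : Finset ι) : ∑ j ∈ Jᶜ, frameExpForm a c J (a j) ≤ frameTraceExp a c J := by
  rw [sum_compl_frameExpForm ha]
  refine Finset.sum_le_sum fun i _ => ?_
  nlinarith [frameEigenvalues_nonneg (a := a) J i, Real.exp_pos (c * frameEigenvalues a J i)]

/-- Eigenvalues above `1 / 2` contribute a negligible amount to `tr exp (-θ S)`, and on the others
the operator `1 - S` is at least `1 / 2`. -/
theorem le_sum_compl_frameExpForm_neg (ha : ∀ v, ∑ j, inner ℝ (a j) v ^ 2 = ‖v‖ ^ 2) {θ : ℝ}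
    (hθ : 0 ≤ θ) (J : Finset ι) :
    (frameTraceExp a (-θ) J - Module.finrank ℝ E * Real.exp (-(θ / 2))) / 2 ≤
      ∑ j ∈ Jᶜ, frameExpForm a (-θ) J (a j) := by
  have e : (Module.finrank ℝ E : ℝ) * Real.exp (-(θ / 2)) =
      ∑ _i : Fin (Module.finrank ℝ E), Real.exp (-(θ / 2)) := by simp
  rw [sum_compl_frameExpForm ha, frameTraceExp, e, ← Finset.sum_sub_distrib, Finset.sum_div]
  refine Finset.sum_le_sum fun i _ => ?_
  have h1 := frameEigenvalues_le_one ha J i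
  have hp := Real.exp_pos (-θ * frameEigenvalues a J i)
  have hp' := Real.exp_pos (-(θ / 2))
  rcases le_total (frameEigenvalues a J i) (1 / 2) with h | h
  · nlinarith
  · have : Real.exp (-θ * frameEigenvalues a J i) ≤ Real.exp (-(θ / 2)) :=
      Real.exp_le_exp.2 (by nlinarith)
    have : 0 ≤ (1 - frameEigenvalues a J i) * Real.exp (-θ * frameEigenvalues a J i) :=
      mul_nonneg (by linarith) hp.le
    linarith

theorem subsetAverage_frameTraceExp_succ_le (ha : ∀ v, ∑ j, inner ℝ (a j) v ^ 2 = ‖v‖ ^ 2)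
    (hb : ∀ j, ‖a j‖ ^ 2 ≤ b) {θ : ℝ} (hθ : 0 ≤ θ) {k : ℕ} (hk : k < Fintype.card ι) :
    subsetAverage ι (k + 1) (frameTraceExp a θ) ≤
      (1 + θ * Real.exp (θ * b) / ((Fintype.card ι : ℝ) - k)) *
        subsetAverage ι k (frameTraceExp a θ) := by
  have h0 : (0 : ℝ) < (Fintype.card ι : ℝ) - k := sub_pos.2 (by exact_mod_cast hk)
  rw [subsetAverage_succ hk, ← subsetAverage_const_mul]
  refine subsetAverage_mono fun J hJ => ?_
  have hc : ((Jᶜ.card : ℕ) : ℝ) = (Fintype.card ι : ℝ) - k := by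
    rw [Finset.card_compl, hJ, Nat.cast_sub hk.le]
  have h1 : ∑ j ∈ Jᶜ, frameTraceExp a θ (insert j J) ≤ ∑ j ∈ Jᶜ,
      (frameTraceExp a θ J + θ * Real.exp (θ * b) * frameExpForm a θ J (a j)) := by
    refine Finset.sum_le_sum fun j hj =>
      (frameTraceExp_insert_le (Finset.mem_compl.1 hj) hθ).trans ?_
    have := frameExpForm_nonneg (a := a) θ J (a j)
    gcongr
    exact hb j
  rw [Finset.sum_add_distrib, Finset.sum_const, nsmul_eq_mul, hc, ← Finset.mul_sum] at h1
  have h2 := mul_le_mul_of_nonneg_left (sum_compl_frameExpForm_le ha θ J)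
    (mul_nonneg hθ (Real.exp_pos (θ * b)).le)
  rw [div_le_iff₀ h0]
  have e : (1 + θ * Real.exp (θ * b) / ((Fintype.card ι : ℝ) - k)) * frameTraceExp a θ J *
      ((Fintype.card ι : ℝ) - k) = ((Fintype.card ι : ℝ) - k) * frameTraceExp a θ J +
        θ * Real.exp (θ * b) * frameTraceExp a θ J := by
    field_simp
  rw [e]
  linarith

/-- One random step contracts the excess of the mean potential over the contribution
`finrank * exp (-θ / 2)` of the eigenspaces where `1 - S` may be small. -/
theorem subsetAverage_frameTraceExp_neg_succ_le (ha : ∀ v, ∑ j, inner ℝ (a j) v ^ 2 = ‖v‖ ^ 2)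
    (hb : ∀ j, ‖a j‖ ^ 2 ≤ b) {θ : ℝ} (hθ : 0 ≤ θ) {k : ℕ} (hk : k < Fintype.card ι) :
    subsetAverage ι (k + 1) (frameTraceExp a (-θ)) - Module.finrank ℝ E * Real.exp (-(θ / 2)) ≤
      (1 - θ * Real.exp (-(θ * b)) / 2 / ((Fintype.card ι : ℝ) - k)) *
        (subsetAverage ι k (frameTraceExp a (-θ)) - Module.finrank ℝ E * Real.exp (-(θ / 2))) := by
  have h0 : (0 : ℝ) < (Fintype.card ι : ℝ) - k := sub_pos.2 (by exact_mod_cast hk)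
  set R : ℝ := Module.finrank ℝ E * Real.exp (-(θ / 2)) with hR
  set q : ℝ := θ * Real.exp (-(θ * b)) / 2 / ((Fintype.card ι : ℝ) - k) with hq
  have key : subsetAverage ι (k + 1) (frameTraceExp a (-θ)) ≤
      subsetAverage ι k (fun J => (1 - q) * frameTraceExp a (-θ) J + q * R) := by
    rw [subsetAverage_succ hk]
    refine subsetAverage_mono fun J hJ => ?_
    have hc : ((Jᶜ.card : ℕ) : ℝ) = (Fintype.card ι : ℝ) - k := by
      rw [Finset.card_compl, hJ, Nat.cast_sub hk.le]
    have h1 : ∑ j ∈ Jᶜ, frameTraceExp a (-θ) (insert j J) ≤ ∑ j ∈ Jᶜ,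
        (frameTraceExp a (-θ) J - θ * Real.exp (-(θ * b)) * frameExpForm a (-θ) J (a j)) := by
      refine Finset.sum_le_sum fun j hj =>
        (frameTraceExp_neg_insert_le (Finset.mem_compl.1 hj) hθ).trans ?_
      have := frameExpForm_nonneg (a := a) (-θ) J (a j)
      gcongr
      exact hb j
    rw [Finset.sum_sub_distrib, Finset.sum_const, nsmul_eq_mul, hc, ← Finset.mul_sum] at h1
    have h2 := mul_le_mul_of_nonneg_left (le_sum_compl_frameExpForm_neg ha hθ J)
      (mul_nonneg hθ (Real.exp_pos (-(θ * b))).le)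
    rw [div_le_iff₀ h0]
    have e : ((1 - q) * frameTraceExp a (-θ) J + q * R) * ((Fintype.card ι : ℝ) - k) =
        ((Fintype.card ι : ℝ) - k) * frameTraceExp a (-θ) J -
          θ * Real.exp (-(θ * b)) * ((frameTraceExp a (-θ) J - R) / 2) := by
      rw [hq]
      field_simp
      ring
    rw [e]
    linarith
  rw [subsetAverage_add, subsetAverage_const_mul, subsetAverage_const hk.le] at key
  linarith

end Frame

/-! ### Tail bounds -/

section Tail

variable {E : Type*} [NormedAddCommGroup E] [InnerProductSpace ℝ E] [FiniteDimensional ℝ E]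
  {ι : Type*} [Fintype ι] {a : ι → E} {b : ℝ}

theorem sum_norm_sq_eq_finrank (ha : ∀ v, ∑ j, inner ℝ (a j) v ^ 2 = ‖v‖ ^ 2) :
    ∑ j, ‖a j‖ ^ 2 = Module.finrank ℝ E := by
  have u := stdOrthonormalBasis ℝ E
  simp only [← sum_sq_inner_eq_norm_sq u]
  rw [Finset.sum_comm]
  simp only [real_inner_comm (a _), ha, u.norm_eq_one]
  simp

variable [DecidableEq ι]

theorem subsetAverage_frameTraceExp_le (ha : ∀ v, ∑ j, inner ℝ (a j) v ^ 2 = ‖v‖ ^ 2)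
    (hb : ∀ j, ‖a j‖ ^ 2 ≤ b) {θ : ℝ} (hθ : 0 ≤ θ) {m : ℕ} (hm : m < Fintype.card ι) :
    subsetAverage ι m (frameTraceExp a θ) ≤
      Module.finrank ℝ E * Real.exp (m * (θ * Real.exp (θ * b) / ((Fintype.card ι : ℝ) - m))) := by
  have hdm : (0 : ℝ) < (Fintype.card ι : ℝ) - m := sub_pos.2 (by exact_mod_cast hm)
  set c : ℝ := θ * Real.exp (θ * b) / ((Fintype.card ι : ℝ) - m) with hc
  suffices ∀ k ≤ m, subsetAverage ι k (frameTraceExp a θ) ≤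
      Module.finrank ℝ E * Real.exp (k * c) from this m le_rfl
  intro k hk
  induction k with
  | zero => simp [subsetAverage_zero, frameTraceExp_empty]
  | succ k ih =>
    have hkm : (k : ℝ) ≤ m := by exact_mod_cast (Nat.le_of_succ_le hk)
    have h1 : 1 + θ * Real.exp (θ * b) / ((Fintype.card ι : ℝ) - k) ≤ Real.exp c := by
      have : θ * Real.exp (θ * b) / ((Fintype.card ι : ℝ) - k) ≤ c := by
        rw [hc]
        gcongr
      linarith [Real.add_one_le_exp c]
    have h2 := ih (Nat.le_of_succ_le hk)
    calc subsetAverage ι (k + 1) (frameTraceExp a θ)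
        ≤ _ := subsetAverage_frameTraceExp_succ_le ha hb hθ ((Nat.lt_of_succ_le hk).trans hm)
      _ ≤ Real.exp c * (Module.finrank ℝ E * Real.exp (k * c)) := by
          refine mul_le_mul h1 h2 ?_ (Real.exp_pos _).le
          exact div_nonneg (Finset.sum_nonneg fun I _ => frameTraceExp_nonneg _ _)
            (Nat.cast_nonneg _)
      _ = _ := by
          push_cast
          rw [add_mul, one_mul, Real.exp_add]
          ring

/-- The potential `tr exp (-θ S)` decreases as the set grows. -/
theorem subsetAverage_frameTraceExp_neg_succ_le_self {θ : ℝ} (hθ : 0 ≤ θ) {k : ℕ}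
    (hk : k < Fintype.card ι) : subsetAverage ι (k + 1) (frameTraceExp a (-θ)) ≤
      subsetAverage ι k (frameTraceExp a (-θ)) := by
  have h0 : (0 : ℝ) < (Fintype.card ι : ℝ) - k := sub_pos.2 (by exact_mod_cast hk)
  rw [subsetAverage_succ hk]
  refine subsetAverage_mono fun J hJ => ?_
  have hc : ((Jᶜ.card : ℕ) : ℝ) = (Fintype.card ι : ℝ) - k := by
    rw [Finset.card_compl, hJ, Nat.cast_sub hk.le]
  rw [div_le_iff₀ h0, mul_comm, ← hc, ← nsmul_eq_mul, ← Finset.sum_const]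
  refine Finset.sum_le_sum fun j hj =>
    (frameTraceExp_neg_insert_le (Finset.mem_compl.1 hj) hθ).trans (sub_le_self _ ?_)
  exact mul_nonneg (mul_nonneg hθ (Real.exp_pos _).le) (frameExpForm_nonneg _ _ _)

theorem subsetAverage_frameTraceExp_neg_le (ha : ∀ v, ∑ j, inner ℝ (a j) v ^ 2 = ‖v‖ ^ 2)
    (hb : ∀ j, ‖a j‖ ^ 2 ≤ b) {θ : ℝ} (hθ : 0 ≤ θ) {m : ℕ} (hm : m ≤ Fintype.card ι) :
    subsetAverage ι m (frameTraceExp a (-θ)) ≤ Module.finrank ℝ E * Real.exp (-(θ / 2)) +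
      Module.finrank ℝ E *
        Real.exp (-(m * (θ * Real.exp (-(θ * b)) / 2 / Fintype.card ι))) := by
  set c : ℝ := θ * Real.exp (-(θ * b)) / 2 / Fintype.card ι with hc
  set R : ℝ := Module.finrank ℝ E * Real.exp (-(θ / 2)) with hR
  have hR0 : 0 ≤ R := by positivity
  induction m with
  | zero => simp [subsetAverage_zero, frameTraceExp_empty, hR0]
  | succ k ih =>
    have hk : k < Fintype.card ι := hm
    have hkd : (0 : ℝ) < (Fintype.card ι : ℝ) - k := sub_pos.2 (by exact_mod_cast hk)
    -- The factor in the recursion is negative near the end of the draw. The recursion is therefore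
    -- only used while the potential exceeds `R`; afterwards monotonicity keeps it below `R`.
    rcases le_total (subsetAverage ι k (frameTraceExp a (-θ))) R with h | h
    · have := subsetAverage_frameTraceExp_neg_succ_le_self (a := a) hθ hk
      have : 0 ≤ (Module.finrank ℝ E : ℝ) * Real.exp (-(((k + 1 : ℕ) : ℝ) * c)) := by positivity
      linarith
    · have h1 : 1 - θ * Real.exp (-(θ * b)) / 2 / ((Fintype.card ι : ℝ) - k) ≤ Real.exp (-c) := by
        have : c ≤ θ * Real.exp (-(θ * b)) / 2 / ((Fintype.card ι : ℝ) - k) := by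
          rw [hc]
          gcongr
          linarith [(Nat.cast_nonneg k : (0 : ℝ) ≤ k)]
        linarith [Real.add_one_le_exp (-c)]
      have h2 := ih hk.le
      have h3 := subsetAverage_frameTraceExp_neg_succ_le ha hb hθ hk
      have h4 := mul_le_mul_of_nonneg_right h1 (sub_nonneg.2 h)
      have h5 := mul_le_mul_of_nonneg_left (sub_le_iff_le_add'.2 h2) (Real.exp_pos (-c)).le
      have e : Real.exp (-c) * (Module.finrank ℝ E * Real.exp (-(k * c))) =
          Module.finrank ℝ E * Real.exp (-(((k + 1 : ℕ) : ℝ) * c)) := by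
        rw [mul_left_comm, ← Real.exp_add]
        push_cast
        ring_nf
      linarith

open Classical in
/-- Lower tail of the matrix Chernoff bound without replacement. -/
theorem subsetAverage_frameEigenvalues_lt_le (ha : ∀ v, ∑ j, inner ℝ (a j) v ^ 2 = ‖v‖ ^ 2)
    (hb : ∀ j, ‖a j‖ ^ 2 ≤ b) (hb0 : 0 < b) {m : ℕ} (hm : m ≤ Fintype.card ι)
    (hd : 0 < Fintype.card ι) :
    subsetAverage ι m
        (fun I => if ∃ i, frameEigenvalues a I i < m / (4 * Fintype.card ι) then 1 else 0) ≤
      2 * Module.finrank ℝ E * Real.exp (-(m / (64 * b * Fintype.card ι))) := by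
  have hd' : (0 : ℝ) < Fintype.card ι := by exact_mod_cast hd
  -- The smoothing parameter keeps a single summand `θ • a j ⊗ a j` of norm at most `1 / 8`.
  obtain ⟨θ, hθ⟩ : ∃ θ : ℝ, θ = 1 / (8 * b) := ⟨_, rfl⟩
  have hθ0 : 0 < θ := by rw [hθ]; positivity
  have hθb : θ * b = 1 / 8 := by rw [hθ]; field_simp
  obtain ⟨p, hp⟩ : ∃ p : ℝ, p = m / Fintype.card ι := ⟨_, rfl⟩
  have hp0 : 0 ≤ p := by rw [hp]; positivity
  have hp1 : p ≤ 1 := by rw [hp, div_le_one hd']; exact_mod_cast hm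
  have e0 : (m : ℝ) / (4 * Fintype.card ι) = p / 4 := by rw [hp]; field_simp
  have e1 : (m : ℝ) / (64 * b * Fintype.card ι) = θ * p / 8 := by
    rw [hp, hθ]; field_simp; norm_num
  have hM := subsetAverage_ite_le (ι := ι) (m := m) (f := frameTraceExp a (-θ))
    (p := fun I => ∃ i, frameEigenvalues a I i < m / (4 * Fintype.card ι))
    (Real.exp_pos (-(θ * (p / 4)))) (fun I _ => frameTraceExp_nonneg _ _) (by
      rintro I - ⟨i, hi⟩
      rw [e0] at hi
      refine le_trans ?_ (Finset.single_le_sum (fun i _ => (Real.exp_pos _).le) (Finset.mem_univ i))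
      exact Real.exp_le_exp.2 (by nlinarith))
  refine hM.trans ?_
  rw [← Real.exp_neg, neg_neg]
  have hA := subsetAverage_frameTraceExp_neg_le ha hb hθ0.le hm
  have h78 : (7 / 8 : ℝ) ≤ Real.exp (-(θ * b)) := by
    rw [hθb]
    linarith [Real.add_one_le_exp (-(1 / 8) : ℝ)]
  have e2 : (m : ℝ) * (θ * Real.exp (-(θ * b)) / 2 / Fintype.card ι) =
      θ * p * Real.exp (-(θ * b)) / 2 := by rw [hp]; field_simp
  rw [e2] at hA
  have hθp : 0 ≤ θ * p := by positivity
  have h1 : Real.exp (θ * (p / 4)) * Real.exp (-(θ / 2)) ≤ Real.exp (-(θ * p / 8)) := by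
    rw [← Real.exp_add]
    exact Real.exp_le_exp.2 (by nlinarith)
  have h2 : Real.exp (θ * (p / 4)) * Real.exp (-(θ * p * Real.exp (-(θ * b)) / 2)) ≤
      Real.exp (-(θ * p / 8)) := by
    rw [← Real.exp_add]
    exact Real.exp_le_exp.2 (by nlinarith)
  rw [e1]
  have hr : (0 : ℝ) ≤ Module.finrank ℝ E := Nat.cast_nonneg _
  have h3 := mul_le_mul_of_nonneg_left hA (Real.exp_pos (θ * (p / 4))).le
  have h4 := mul_le_mul_of_nonneg_left h1 hr
  have h5 := mul_le_mul_of_nonneg_left h2 hr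
  linarith

open Classical in
/-- Upper tail of the matrix Chernoff bound without replacement. Once more than a `4 / 9` fraction
of the vectors is sampled, the threshold exceeds `1` and the event is empty; below that, at least a
`5 / 9` fraction remains to draw from at every step, and `9 / 5 < 9 / 4` leaves room for the
exponential gain. -/
theorem subsetAverage_lt_frameEigenvalues_le (ha : ∀ v, ∑ j, inner ℝ (a j) v ^ 2 = ‖v‖ ^ 2)
    (hb : ∀ j, ‖a j‖ ^ 2 ≤ b) (hb0 : 0 < b) {m : ℕ} (hd : 0 < Fintype.card ι) :
    subsetAverage ι m
        (fun I => if ∃ i, 9 * m / (4 * Fintype.card ι) < frameEigenvalues a I i then 1 else 0) ≤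
      Module.finrank ℝ E * Real.exp (-(m / (64 * b * Fintype.card ι))) := by
  have hd' : (0 : ℝ) < Fintype.card ι := by exact_mod_cast hd
  obtain ⟨θ, hθ⟩ : ∃ θ : ℝ, θ = 1 / (8 * b) := ⟨_, rfl⟩
  have hθ0 : 0 < θ := by rw [hθ]; positivity
  have hθb : θ * b = 1 / 8 := by rw [hθ]; field_simp
  obtain ⟨p, hp⟩ : ∃ p : ℝ, p = m / Fintype.card ι := ⟨_, rfl⟩
  have hp0 : 0 ≤ p := by rw [hp]; positivity
  have hmp : (m : ℝ) = p * Fintype.card ι := by rw [hp]; field_simp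
  have e0 : 9 * (m : ℝ) / (4 * Fintype.card ι) = 9 * p / 4 := by rw [hp]; field_simp
  have e1 : (m : ℝ) / (64 * b * Fintype.card ι) = θ * p / 8 := by
    rw [hp, hθ]; field_simp; norm_num
  rw [e0, e1]
  rcases lt_or_ge (4 / 9) p with hp9 | hp9
  · have hnot : ∀ I : Finset ι, ¬ ∃ i, 9 * p / 4 < frameEigenvalues a I i := by
      rintro I ⟨i, hi⟩
      linarith [frameEigenvalues_le_one ha I i]
    simp only [hnot, if_false]
    rw [subsetAverage]
    simp only [Finset.sum_const_zero, zero_div]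
    positivity
  have hM := subsetAverage_ite_le (ι := ι) (m := m) (f := frameTraceExp a θ)
    (p := fun I => ∃ i, 9 * p / 4 < frameEigenvalues a I i)
    (Real.exp_pos (θ * (9 * p / 4))) (fun I _ => frameTraceExp_nonneg _ _) (by
      rintro I - ⟨i, hi⟩
      refine le_trans ?_ (Finset.single_le_sum (fun i _ => (Real.exp_pos _).le) (Finset.mem_univ i))
      exact Real.exp_le_exp.2 (by nlinarith))
  refine hM.trans ?_
  rw [← Real.exp_neg]
  have hmd : m < Fintype.card ι := by
    have : (m : ℝ) < Fintype.card ι := by rw [hmp]; nlinarith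
    exact_mod_cast this
  have hA := subsetAverage_frameTraceExp_le ha hb hθ0.le hmd
  have h87 : Real.exp (θ * b) ≤ 8 / 7 := by
    have h : (7 / 8 : ℝ) ≤ Real.exp (-(1 / 8)) := by linarith [Real.add_one_le_exp (-(1 / 8) : ℝ)]
    rw [Real.exp_neg] at h
    rw [hθb]
    have := inv_anti₀ (by norm_num) h
    rw [inv_inv] at this
    norm_num at this ⊢
    exact this
  have h1 : (m : ℝ) * (θ * Real.exp (θ * b) / ((Fintype.card ι : ℝ) - m)) ≤
      θ * p * (72 / 35) := by
    have h9 : 5 / 9 * (Fintype.card ι : ℝ) ≤ (Fintype.card ι : ℝ) - m := by rw [hmp]; nlinarith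
    have h10 : θ * Real.exp (θ * b) / ((Fintype.card ι : ℝ) - m) ≤
        θ * (8 / 7) / (5 / 9 * (Fintype.card ι : ℝ)) := by
      gcongr
    refine (mul_le_mul_of_nonneg_left h10 (Nat.cast_nonneg m)).trans (le_of_eq ?_)
    rw [hmp]
    field_simp
    ring
  have hθp : 0 ≤ θ * p := by positivity
  calc Real.exp (-(θ * (9 * p / 4))) * subsetAverage ι m (frameTraceExp a θ)
      ≤ Real.exp (-(θ * (9 * p / 4))) * (Module.finrank ℝ E * Real.exp (θ * p * (72 / 35))) :=
        mul_le_mul_of_nonneg_left (hA.trans (mul_le_mul_of_nonneg_left (Real.exp_le_exp.2 h1)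
          (Nat.cast_nonneg _))) (Real.exp_pos _).le
    _ = Module.finrank ℝ E * Real.exp (-(θ * (9 * p / 4)) + θ * p * (72 / 35)) := by
        rw [Real.exp_add]; ring
    _ ≤ _ := by
        refine mul_le_mul_of_nonneg_left (Real.exp_le_exp.2 ?_) (Nat.cast_nonneg _)
        linarith

/-- The failure event: some eigenvalue of the partial frame operator of `m` vectors leaves the
interval `[1 / 4, 9 / 4] · m / card ι`. -/
def FrameEigenvaluesEscape (a : ι → E) (m : ℕ) (I : Finset ι) : Prop :=
  ∃ i, frameEigenvalues a I i < m / (4 * Fintype.card ι) ∨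
    9 * m / (4 * Fintype.card ι) < frameEigenvalues a I i

open Classical in
theorem subsetAverage_escape_le (ha : ∀ v, ∑ j, inner ℝ (a j) v ^ 2 = ‖v‖ ^ 2)
    (hb : ∀ j, ‖a j‖ ^ 2 ≤ b) (hb0 : 0 < b) {m : ℕ} (hm : m ≤ Fintype.card ι)
    (hd : 0 < Fintype.card ι) :
    subsetAverage ι m (fun I => if FrameEigenvaluesEscape a m I then 1 else 0) ≤
      3 * Module.finrank ℝ E * Real.exp (-(m / (64 * b * Fintype.card ι))) := by
  have h1 := subsetAverage_frameEigenvalues_lt_le ha hb hb0 hm hd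
  have h2 := subsetAverage_lt_frameEigenvalues_le (m := m) ha hb hb0 hd
  have h3 : subsetAverage ι m (fun I => if FrameEigenvaluesEscape a m I then 1 else 0) ≤ _ :=
    subsetAverage_mono (g := fun I =>
      (if ∃ i, frameEigenvalues a I i < m / (4 * Fintype.card ι) then 1 else 0) +
      (if ∃ i, 9 * m / (4 * Fintype.card ι) < frameEigenvalues a I i then 1 else 0)) (by
      intro I _
      by_cases h : FrameEigenvaluesEscape a m I
      · obtain ⟨i, hi | hi⟩ := id h
        · rw [if_pos h, if_pos ⟨i, hi⟩]
          split_ifs <;> norm_num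
        · rw [if_pos h, if_pos (c := ∃ i, _ < frameEigenvalues a I i) ⟨i, hi⟩]
          split_ifs <;> norm_num
      · rw [if_neg h]
        positivity)
  rw [subsetAverage_add] at h3
  linarith

open Classical in
/-- In dimension one the only eigenvalue is `∑ j ∈ I, ‖a j‖ ^ 2`, and Markov's inequality for its
distance to the maximal value `m * b` bounds the failure probability even where the exponential
bound is vacuous. -/
theorem subsetAverage_escape_le_of_finrank_eq_one
    (ha : ∀ v, ∑ j, inner ℝ (a j) v ^ 2 = ‖v‖ ^ 2) (hb : ∀ j, ‖a j‖ ^ 2 ≤ b)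
    (hr : Module.finrank ℝ E = 1) {m : ℕ} (hm0 : 0 < m) (hm : m ≤ Fintype.card ι)
    (hb1 : 1 ≤ b * Fintype.card ι) (hb2 : b * Fintype.card ι ≤ 2) :
    subsetAverage ι m (fun I => if FrameEigenvaluesEscape a m I then 1 else 0) ≤
      (b * Fintype.card ι - 1) / (b * Fintype.card ι - 1 / 4) := by
  have hd' : (0 : ℝ) < Fintype.card ι := by exact_mod_cast hm0.trans_le hm
  have hm' : (0 : ℝ) < m := by exact_mod_cast hm0
  have hsum : ∀ I : Finset ι, I.card = m → ∑ j ∈ I, ‖a j‖ ^ 2 ≤ m * b := fun I hI => by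
    rw [← hI, ← nsmul_eq_mul]
    exact Finset.sum_le_card_nsmul _ _ _ fun j _ => hb j
  have heig : ∀ (I : Finset ι) i, frameEigenvalues a I i = ∑ j ∈ I, ‖a j‖ ^ 2 := fun I i => by
    have : Subsingleton (Fin (Module.finrank ℝ E)) := by rw [hr]; infer_instance
    rw [frameEigenvalues_eq_sum]
    refine Finset.sum_congr rfl fun j _ => ?_
    rw [← sum_sq_inner_eq_norm_sq (frameEigenbasis a I), Fintype.sum_subsingleton _ i,
      real_inner_comm]
  have hpos : 0 < m * (b - 1 / (4 * Fintype.card ι)) := by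
    refine mul_pos hm' (sub_pos.2 ?_)
    rw [div_lt_iff₀ (by positivity)]
    linarith
  have hM := subsetAverage_ite_le (ι := ι) (m := m) (f := fun I => m * b + -1 * ∑ j ∈ I, ‖a j‖ ^ 2)
    (p := FrameEigenvaluesEscape a m) hpos
    (fun I hI => by linarith [hsum I hI]) (by
      rintro I hI ⟨i, hi | hi⟩
      · rw [heig] at hi
        have : (m : ℝ) / (4 * Fintype.card ι) = m * (1 / (4 * Fintype.card ι)) := by ring
        rw [this] at hi
        linarith
      · rw [heig, div_lt_iff₀ (by positivity)] at hi
        nlinarith [hsum I hI])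
  refine hM.trans (le_of_eq ?_)
  rw [subsetAverage_add, subsetAverage_const hm, subsetAverage_const_mul, subsetAverage_sum hm,
    sum_norm_sq_eq_finrank ha, hr]
  have h4 : b * Fintype.card ι - 1 / 4 ≠ 0 := by linarith
  have h5 : b - 1 / (4 * (Fintype.card ι : ℝ)) =
      (b * Fintype.card ι - 1 / 4) / Fintype.card ι := by field_simp
  rw [h5]
  push_cast
  field_simp
  ring

end Tail

/-! ### Row submatrices and their singular values -/

section Rows

variable {d r : ℕ}

/-- The rows of a matrix as vectors of Euclidean space. -/
def rowVector (U : Matrix (Fin d) (Fin r) ℝ) (j : Fin d) : EuclideanSpace ℝ (Fin r) :=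
  WithLp.toLp 2 (U j)

theorem inner_rowVector (U : Matrix (Fin d) (Fin r) ℝ) (j : Fin d) (v : EuclideanSpace ℝ (Fin r)) :
    inner ℝ (rowVector U j) v = Matrix.mulVec U v.ofLp j := by
  simp [rowVector, PiLp.inner_apply, Matrix.mulVec, dotProduct, mul_comm]

/-- Orthonormal columns mean that the rows form a Parseval frame. -/
theorem sum_sq_inner_rowVector {U : Matrix (Fin d) (Fin r) ℝ} (hU : U.transpose * U = 1)
    (v : EuclideanSpace ℝ (Fin r)) : ∑ j, inner ℝ (rowVector U j) v ^ 2 = ‖v‖ ^ 2 := by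
  have h : Matrix.mulVec U v.ofLp ⬝ᵥ Matrix.mulVec U v.ofLp = v.ofLp ⬝ᵥ v.ofLp := by
    rw [Matrix.dotProduct_mulVec, Matrix.vecMul_mulVec, hU, Matrix.vecMul_one]
  rw [EuclideanSpace.real_norm_sq_eq]
  simp only [inner_rowVector, sq]
  exact h

theorem adjoint_comp_self_rowSubmatrix (U : Matrix (Fin d) (Fin r) ℝ) (I : Finset (Fin d)) :
    LinearMap.adjoint (Matrix.toEuclideanLin (rowSubmatrix U I)) ∘ₗ
      Matrix.toEuclideanLin (rowSubmatrix U I) = partialFrameOp (rowVector U) I := by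
  ext1 w
  refine ext_inner_left ℝ fun v => ?_
  rw [LinearMap.comp_apply, LinearMap.adjoint_inner_right, inner_partialFrameOp,
    PiLp.inner_apply, ← Finset.sum_coe_sort I]
  refine Finset.sum_congr rfl fun j _ => ?_
  rw [inner_rowVector, inner_rowVector]
  simp [Matrix.toLpLin_apply, rowSubmatrix, Matrix.mulVec, dotProduct, mul_comm]

/-- Every squared singular value of a row submatrix, up to index `r - 1`, is an eigenvalue of the
partial frame operator; the submatrix may have fewer than `r` rows. -/
theorem exists_frameEigenvalues_eq_sq_singularValue (U : Matrix (Fin d) (Fin r) ℝ)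
    (I : Finset (Fin d)) {k : ℕ} (hk : k < r) :
    ∃ i, frameEigenvalues (rowVector U) I i =
      (Matrix.toEuclideanLin (rowSubmatrix U I)).singularValues k ^ 2 := by
  have h := (Matrix.toEuclideanLin
    (rowSubmatrix U I)).hasEigenvalue_adjoint_comp_self_sq_singularValues (n := k) (by simpa)
  rw [adjoint_comp_self_rowSubmatrix] at h
  exact (isSymmetric_partialFrameOp (rowVector U) I).exists_eigenvalues_eq rfl h

theorem singularValues_bounds_of_not_escape (U : Matrix (Fin d) (Fin r) ℝ) (I : Finset (Fin d))
    (hr : 0 < r) {m : ℕ} (h : ¬ FrameEigenvaluesEscape (rowVector U) m I) :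
    1 / 2 * √(m / d) ≤ sigmaMin (rowSubmatrix U I) ∧
      sigmaMin (rowSubmatrix U I) ≤ sigmaMax (rowSubmatrix U I) ∧
      sigmaMax (rowSubmatrix U I) ≤ 3 / 2 * √(m / d) := by
  have hmd : (0 : ℝ) ≤ m / d := by positivity
  simp only [FrameEigenvaluesEscape, not_exists, not_or, not_lt, Fintype.card_fin] at h
  refine ⟨?_, LinearMap.singularValues_antitone _ (Nat.zero_le _), ?_⟩
  · obtain ⟨i, hi⟩ := exists_frameEigenvalues_eq_sq_singularValue U I (Nat.sub_lt hr one_pos)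
    refine le_of_sq_le_sq ?_ (LinearMap.singularValues_nonneg _ _)
    rw [sigmaMin, ← hi, mul_pow, Real.sq_sqrt hmd]
    refine le_trans (le_of_eq ?_) (h i).1
    ring
  · obtain ⟨i, hi⟩ := exists_frameEigenvalues_eq_sq_singularValue U I hr
    refine le_of_sq_le_sq ?_ (by positivity)
    rw [sigmaMax, ← hi, mul_pow, Real.sq_sqrt hmd]
    refine (h i).2.trans (le_of_eq ?_)
    ring

open Classical in
theorem uniformSubset_real_eq {m : ℕ} (A : Set (Finset (Fin d))) :
    (uniformSubset d m).real A = subsetAverage (Fin d) m fun I => if I ∈ A then 1 else 0 := by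
  have hs : {I : Finset (Fin d) | I.card = m} =
      (((Finset.univ : Finset (Fin d)).powersetCard m : Finset (Finset (Fin d))) :
        Set (Finset (Fin d))) := by
    ext I
    simp [Finset.mem_powersetCard]
  have hA : A = ((Finset.univ.filter (· ∈ A) : Finset (Finset (Fin d))) :
      Set (Finset (Fin d))) := by
    ext I
    simp
  conv_lhs => rw [hA]
  rw [MeasureTheory.measureReal_def, uniformSubset, hs, ProbabilityTheory.uniformOn_apply_finset,
    ENNReal.toReal_div, ENNReal.toReal_natCast, ENNReal.toReal_natCast, subsetAverage,
    Finset.card_powersetCard, Finset.card_univ]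
  rw [Finset.sum_boole]
  congr 3
  ext I
  simp

theorem one_sub_le_uniformSubset_of_escape_le {U : Matrix (Fin d) (Fin r) ℝ} (hr : 0 < r) {m : ℕ}
    (hm : m ≤ d) {δ : ℝ} (h : open Classical in subsetAverage (Fin d) m
      (fun I => if FrameEigenvaluesEscape (rowVector U) m I then 1 else 0) ≤ δ) :
    1 - δ ≤ (uniformSubset d m).real
      {I | 1 / 2 * √(m / d) ≤ sigmaMin (rowSubmatrix U I) ∧
        sigmaMin (rowSubmatrix U I) ≤ sigmaMax (rowSubmatrix U I) ∧
        sigmaMax (rowSubmatrix U I) ≤ 3 / 2 * √(m / d)} := by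
  classical
  rw [uniformSubset_real_eq, sub_le_iff_le_add]
  refine le_trans ?_ (add_le_add_right h _)
  rw [← subsetAverage_add]
  refine (subsetAverage_const (ι := Fin d) (by simpa using hm) 1).ge.trans ?_
  refine subsetAverage_mono fun I _ => ?_
  by_cases hI : FrameEigenvaluesEscape (rowVector U) m I
  · rw [if_pos hI]
    split_ifs <;> norm_num
  · rw [if_neg hI, if_pos (by exact singularValues_bounds_of_not_escape U I hr hI)]
    norm_num

end Rows

/-! ### From the tail bounds to the sample size -/

/-- For `μ * r / δ ≥ 2` the cubed logarithm is at least a fixed multiple of the logarithm, and the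
constant `500` turns the exponential failure bound into `δ`. -/
theorem three_mul_exp_neg_le {r μ δ m : ℝ} (hr : 0 < r) (hμ : 1 ≤ μ) (hδ : 0 < δ)
    (hx : 2 ≤ μ * r / δ) (hm : 500 * μ * r * Real.log (μ * r / δ) ^ 3 ≤ m) :
    3 * r * Real.exp (-(m / (64 * (μ * r)))) ≤ δ := by
  obtain ⟨x, hx'⟩ : ∃ x, x = μ * r / δ := ⟨_, rfl⟩
  rw [← hx'] at hx hm
  have hx0 : 0 < x := by linarith
  obtain ⟨L, hL⟩ : ∃ L, L = Real.log x := ⟨_, rfl⟩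
  have hL2 : 0.69 ≤ L := by
    have := Real.log_le_log two_pos hx
    have := Real.log_two_gt_d9
    rw [hL]; linarith
  rw [← hL] at hm
  have h1 : 3 * L ≤ m / (64 * (μ * r)) := by
    rw [le_div_iff₀ (by positivity)]
    refine le_trans ?_ hm
    have h2 : 192 * L ≤ 500 * L ^ 3 := by
      have : 0.4761 ≤ L ^ 2 := by nlinarith
      nlinarith
    have := mul_le_mul_of_nonneg_left h2 (by positivity : 0 ≤ μ * r)
    linarith
  have hexp : Real.exp (-(m / (64 * (μ * r)))) ≤ (x ^ 3)⁻¹ := by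
    have : (x ^ 3)⁻¹ = Real.exp (-(3 * L)) := by
      rw [Real.exp_neg, show (3 : ℝ) * L = (3 : ℕ) * L by norm_num, Real.exp_nat_mul, hL,
        Real.exp_log hx0]
    rw [this]
    exact Real.exp_le_exp.2 (neg_le_neg h1)
  have hrx : r ≤ δ * x := by
    rw [hx', mul_div_cancel₀ _ hδ.ne']
    nlinarith
  calc 3 * r * Real.exp (-(m / (64 * (μ * r)))) ≤ 3 * (δ * x) * (x ^ 3)⁻¹ := by gcongr
    _ = δ * (3 / x ^ 2) := by field_simp
    _ ≤ δ * 1 := by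
        refine mul_le_mul_of_nonneg_left ?_ hδ.le
        rw [div_le_one (by positivity)]
        nlinarith
    _ = δ := mul_one δ

theorem theorem2 :
    ∃ c₀ : ℝ, 0 < c₀ ∧
      ∀ (n : ℕ) (d r : Fin n → ℕ) (L : RealTensor d)
        (U : ∀ k, Matrix (Fin (d k)) (Fin (r k)) ℝ) (μ : ℝ),
        IsTuckerFactorSystem L U →
        (∀ k, IsIncoherent (U k) μ) →
        ∀ (i : Fin n), 0 < r i →
        ∀ δ : ℝ, 0 < δ → δ < 1 →
        ∀ m : ℕ, m ≤ d i →
          c₀ * μ * r i * Real.log (μ * r i / δ) ^ 3 ≤ m →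
          1 - δ ≤ (uniformSubset (d i) m).real
            {I | 1 / 2 * √(m / d i) ≤ sigmaMin (rowSubmatrix (U i) I) ∧
              sigmaMin (rowSubmatrix (U i) I) ≤ sigmaMax (rowSubmatrix (U i) I) ∧
              sigmaMax (rowSubmatrix (U i) I) ≤ 3 / 2 * √(m / d i)} := by
  classical
  refine ⟨500, by norm_num, ?_⟩
  intro n d r L U μ hT hinc i hr δ hδ hδ1 m hm hlog
  have ha := sum_sq_inner_rowVector (hT.orthonormal_columns i)
  have hsum := sum_norm_sq_eq_finrank ha
  rw [finrank_euclideanSpace_fin] at hsum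
  have hr' : (1 : ℝ) ≤ r i := by exact_mod_cast hr
  have hd : 0 < d i := by
    rcases Nat.eq_zero_or_pos (d i) with h | h
    · have : IsEmpty (Fin (d i)) := by rw [h]; infer_instance
      rw [Finset.univ_eq_empty, Finset.sum_empty] at hsum
      linarith
    · exact h
  have hd' : (0 : ℝ) < d i := by exact_mod_cast hd
  -- The squared row norms sum to `r i`; in particular `√(μ * r / d)` cannot be the junk value at a
  -- negative argument, and `1 ≤ μ`.
  have hμ : 1 ≤ μ := by
    by_contra! hlt
    have hlt' : ∀ j, ‖rowVector (U i) j‖ ^ 2 < r i / d i := fun j => by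
      have h := hinc i j
      refine lt_of_le_of_lt (pow_le_pow_left₀ (norm_nonneg _) h 2) ?_
      rcases le_total 0 (μ * r i / d i) with h0 | h0
      · rw [Real.sq_sqrt h0]
        exact div_lt_div_of_pos_right (by nlinarith) hd'
      · rw [Real.sqrt_eq_zero_of_nonpos h0, zero_pow two_ne_zero]
        positivity
    have : Nonempty (Fin (d i)) := ⟨⟨0, hd⟩⟩
    have h := Finset.sum_lt_sum_of_nonempty Finset.univ_nonempty fun j _ => hlt' j
    rw [hsum, Finset.sum_const, Finset.card_univ, Fintype.card_fin, nsmul_eq_mul,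
      mul_div_cancel₀ _ hd'.ne'] at h
    exact lt_irrefl _ h
  have hμ0 : 0 < μ := one_pos.trans_le hμ
  have hb : ∀ j, ‖rowVector (U i) j‖ ^ 2 ≤ μ * r i / d i := fun j => by
    have h := pow_le_pow_left₀ (norm_nonneg _) (hinc i j) 2
    rwa [Real.sq_sqrt (by positivity)] at h
  have hbd : μ * r i / d i * d i = μ * r i := div_mul_cancel₀ _ hd'.ne'
  refine one_sub_le_uniformSubset_of_escape_le hr hm ?_
  rcases le_or_gt 2 (μ * r i / δ) with hx | hx
  · have h := subsetAverage_escape_le ha hb (by positivity) (m := m) (by simpa using hm)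
      (by simpa using hd)
    rw [finrank_euclideanSpace_fin, Fintype.card_fin, mul_assoc 64, hbd] at h
    exact h.trans (three_mul_exp_neg_le (by positivity) hμ hδ hx hlog)
  · -- Here `μ * r < 2 * δ < 2` forces `r = 1`.
    rw [div_lt_iff₀ hδ] at hx
    have hr1 : r i = 1 := by
      have : (r i : ℝ) < 2 := by nlinarith
      have : r i < 2 := by exact_mod_cast this
      omega
    -- The logarithm may be tiny here, but it is positive, which is all that is needed.
    have hm0 : 0 < m := by
      have hlogpos : 0 < Real.log (μ * r i / δ) :=
        Real.log_pos (by rw [one_lt_div hδ]; nlinarith)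
      have : (0 : ℝ) < m := lt_of_lt_of_le (by positivity) hlog
      exact_mod_cast this
    have hμr : μ * r i = μ := by rw [hr1, Nat.cast_one, mul_one]
    have h := subsetAverage_escape_le_of_finrank_eq_one ha hb (by simpa using hr1) hm0
      (by simpa using hm) (by rw [Fintype.card_fin, hbd, hμr]; exact hμ)
      (by rw [Fintype.card_fin, hbd]; linarith)
    rw [Fintype.card_fin, hbd, hμr] at h
    rw [hμr] at hx
    refine h.trans ?_
    rw [div_le_iff₀ (by linarith)]
    nlinarith [sq_nonneg (μ - 9 / 8)]
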